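/- Let $I\subset\mathbb R$ be compact, let $M\ge 0$, $c>0$, $R_0>0$ and $0<a\le b$, and put $\varepsilon(h)=\dfrac{c}{\log(R_0/h)}$ for $0<h<R_0$. Then there are constants $C_0>0$ and $h_0>0$, depending only on $I,M,c,R_0,a,b$, such that the following holds for every $h\in(0,h_0)$. Let $D_h=B(p,r)\subset\mathbb R^2$ be an open disc with arbitrary centre $p$, and let $2D_h=B(p,2r)$ be the concentric disc of twice the radius, where the radius of $2D_h$ is comparable to $h\varepsilon(h)$ in the sense that $$a\,h\varepsilon(h)\le 2r\le b\,h\varepsilon(h).$$ Let $E\in I$, let $V\in L^\infty(2D_h,\mathbb R)$ with $\|V\|_{L^\infty(2D_h)}\le M$, and let $u_h\in L^1_{\mathrm{loc}}(2D_h,\mathbb R)$ be a solution of $$(-h^2\Delta+V-E)\,u_h=0\quad\text{on }2D_h$$ in the sense of distributions. Then $$\int_{D_h}|u_h(x)|^2\,dx\;\le\; C_0\int_{2D_h\setminus D_h}|u_h(x)|^2\,dx ,$$ both sides being understood in $[0,\infty]$. In particular $C_0$ is independent of $h$ and $u_h$ (and of $E\in I$, of $p$, and of $V$ as long as $\|V\|_{L^\infty}\le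 M$). -/

import Mathlib

open MeasureTheory
open scoped ContDiff NNReal ENNReal

/-- The Euclidean plane `ℝ²`, with the Euclidean norm and Lebesgue measure. -/
abbrev Plane : Type := EuclideanSpace ℝ (Fin 2)

/-- The shrinking parameter `ε(h) = c / log (R₀ / h)`; it is positive for `0 < h < R₀` and `c > 0`,
and tends to `0` as `h → 0⁺`. -/
noncomputable def shrinkParam (c R₀ h : ℝ) : ℝ := c / Real.log (R₀ / h)

/-- `u ∈ L¹_loc(Ω)` solves `(-h² Δ + V - E) u = 0` on the open set `Ω ⊆ ℝ²` in the sense of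
distributions, i.e. when tested against every `φ ∈ C_c^∞(Ω)`. -/
structure IsSchrodingerSolutionOn (h E : ℝ) (V u : Plane → ℝ) (Ω : Set Plane) : Prop where
  locallyIntegrableOn : LocallyIntegrableOn u Ω volume
  integral_eq_zero : ∀ φ : Plane → ℝ, ContDiff ℝ ∞ φ → HasCompactSupport φ → tsupport φ ⊆ Ω →
    ∫ x in Ω, u x * (-h ^ 2 * Laplacian.laplacian φ x + (V x - E) * φ x) = 0

/-! Substituting `x = p + s y` with `s = r / ρ` turns the equation into `Δu = W u` on the ball of
radius `2ρ`, where `W = (s/h)² (V - E)`. Since `s/h = O(ε(h))` and `ε(h) → 0`, `|W| ≤ 1` for small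
`h`, so one estimate at a fixed small `ρ` suffices (`exists_ball_lintegral_le_annulus`).

At unit scale, let `χ` be a cutoff equal to 1 on the inner ball and `v = χ u`. As `u` is only
locally integrable, `v` is estimated by duality. For Schwartz `η`, solve `Δφ = κ (φ - η)` with `κ =
(2π)²` and test the equation against `χ φ`: `κ ∫ η v = ∫ (κ - W) φ v + ∫ u [Δ, χ] φ`. The commutator
lives on the annulus, and `H² ⊂ L^∞` in dimension below 4 gives `|φ| ≤ c ‖η‖₂`. Hence `‖v‖₂ ≤ 2c
‖v‖₁ + B ‖u‖_{L²(annulus)}`. On a small ball `2c ‖v‖₁ ≤ ‖v‖₂ / 2`, which is absorbed on the left. -/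

open scoped SchwartzMap FourierTransform LineDeriv Laplacian

/-! ### Fourier bounds for the resolvent of the Laplacian -/

section FourierMultiplier

variable {E : Type*} [NormedAddCommGroup E] [InnerProductSpace ℝ E] [FiniteDimensional ℝ E]
  [MeasurableSpace E] [BorelSpace E]

/-- The operator `(1 - Δ / (2π)²)⁻¹` on Schwartz functions. -/
noncomputable def schwartzResolvent (η : 𝓢(E, ℂ)) : 𝓢(E, ℂ) :=
  SchwartzMap.fourierMultiplierCLM ℂ (fun ξ : E ↦ (1 + ‖ξ‖ ^ 2) ^ (-1 : ℝ)) η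

theorem fourier_schwartzResolvent_apply (η : 𝓢(E, ℂ)) (ξ : E) :
    𝓕 (schwartzResolvent η) ξ = ((1 + ‖ξ‖ ^ 2) ^ (-1 : ℝ) : ℝ) • 𝓕 η ξ := by
  rw [schwartzResolvent, SchwartzMap.fourierMultiplierCLM_apply,
    FourierTransform.fourier_fourierInv_eq, SchwartzMap.smulLeftCLM_apply_apply (by fun_prop)]

/-- On the Fourier side `Δ` is multiplication by `-(2π)² ‖ξ‖²`, and `-‖ξ‖² / (1 + ‖ξ‖²) = 1 / (1 +
‖ξ‖²) - 1`. -/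
theorem laplacian_schwartzResolvent (η : 𝓢(E, ℂ)) :
    Δ (schwartzResolvent η) = (2 * Real.pi) ^ 2 • (schwartzResolvent η - η) := by
  rw [SchwartzMap.laplacian_eq_fourierMultiplierCLM, ← sub_eq_zero, neg_smul]
  rw [← neg_add', neg_eq_zero, ← smul_add, smul_eq_zero_iff_right (by positivity)]
  have hinj : Function.Injective (𝓕 : 𝓢(E, ℂ) → 𝓢(E, ℂ)) :=
    Function.LeftInverse.injective (g := 𝓕⁻) FourierTransform.fourierInv_fourier_eq
  apply hinj
  ext ξ
  rw [← neg_sub, ← sub_eq_add_neg]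
  simp only [sub_eq_add_neg, FourierTransform.fourier_add, FourierTransform.fourier_neg,
    SchwartzMap.fourierMultiplierCLM_apply,
    FourierTransform.fourier_fourierInv_eq, _root_.add_apply, _root_.neg_apply]
  rw [SchwartzMap.smulLeftCLM_apply_apply (by fun_prop), fourier_schwartzResolvent_apply]
  have hz : 𝓕 (0 : 𝓢(E, ℂ)) ξ = 0 := by
    simp
  have h : (1 + (‖ξ‖ : ℂ) ^ 2) ≠ 0 := by
    exact_mod_cast (by positivity : (1 + ‖ξ‖ ^ 2) ≠ 0)
  rw [hz]
  simp only [Real.rpow_neg_one, Complex.real_smul]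
  push_cast
  field_simp
  ring

theorem norm_toLp_two_le_of_fourier_le {f g : 𝓢(E, ℂ)} {c : ℝ}
    (h : ∀ ξ, ‖𝓕 f ξ‖ ≤ c * ‖𝓕 g ξ‖) : ‖f.toLp 2‖ ≤ c * ‖g.toLp 2‖ := by
  rw [← SchwartzMap.norm_fourier_toL2_eq, ← SchwartzMap.norm_fourier_toL2_eq g]
  apply Lp.norm_le_mul_norm_of_ae_le_mul
  filter_upwards [(𝓕 f).coeFn_toLp 2, (𝓕 g).coeFn_toLp 2] with ξ h1 h2
  rw [h1, h2]
  exact h ξ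

theorem rpow_neg_one_one_add_sq_le_one {F : Type*} [NormedAddCommGroup F] (ξ : F) :
    ((1 + ‖ξ‖ ^ 2) ^ (-1 : ℝ) : ℝ) ≤ 1 := by
  rw [Real.rpow_neg_one]
  exact inv_le_one_of_one_le₀ (by nlinarith [sq_nonneg ‖ξ‖])

theorem norm_toLp_schwartzResolvent_le (η : 𝓢(E, ℂ)) :
    ‖(schwartzResolvent η).toLp 2‖ ≤ ‖η.toLp 2‖ := by
  rw [← one_mul ‖η.toLp 2 volume‖]
  refine norm_toLp_two_le_of_fourier_le fun ξ ↦ ?_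
  rw [fourier_schwartzResolvent_apply, norm_smul, Real.norm_of_nonneg (by positivity)]
  gcongr
  exact rpow_neg_one_one_add_sq_le_one ξ

theorem norm_toLp_lineDeriv_schwartzResolvent_le (η : 𝓢(E, ℂ)) (m : E) :
    ‖(∂_{m} (schwartzResolvent η)).toLp 2‖ ≤ 2 * Real.pi * ‖m‖ * ‖η.toLp 2‖ := by
  refine norm_toLp_two_le_of_fourier_le fun ξ ↦ ?_
  rw [SchwartzMap.fourier_lineDerivOp_eq, _root_.smul_apply,
    SchwartzMap.smulLeftCLM_apply_apply (by fun_prop), fourier_schwartzResolvent_apply,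
    norm_smul, norm_smul, norm_smul, Real.rpow_neg_one, norm_inv,
    Real.norm_of_nonneg (by positivity : 0 ≤ 1 + ‖ξ‖ ^ 2)]
  have h1 : ‖(2 * Real.pi * Complex.I : ℂ)‖ = 2 * Real.pi := by
    simp [abs_of_pos Real.pi_pos]
  have h2 : ‖inner ℝ ξ m‖ * (1 + ‖ξ‖ ^ 2)⁻¹ ≤ ‖m‖ := by
    -- Cauchy–Schwarz together with `‖ξ‖ ≤ 1 + ‖ξ‖²`.
    rw [← div_eq_mul_inv, div_le_iff₀ (by positivity)]
    nlinarith [norm_inner_le_norm (𝕜 := ℝ) ξ m, norm_nonneg m, sq_nonneg (‖ξ‖ - 1),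
      mul_nonneg (norm_nonneg m) (sq_nonneg (‖ξ‖ - 1)), mul_nonneg (norm_nonneg m) (sq_nonneg ‖ξ‖)]
  rw [h1]
  calc 2 * Real.pi * (‖inner ℝ ξ m‖ * ((1 + ‖ξ‖ ^ 2)⁻¹ * ‖𝓕 η ξ‖))
      = 2 * Real.pi * (‖inner ℝ ξ m‖ * (1 + ‖ξ‖ ^ 2)⁻¹) * ‖𝓕 η ξ‖ := by ring
    _ ≤ 2 * Real.pi * ‖m‖ * ‖𝓕 η ξ‖ := by gcongr

theorem memLp_two_one_add_sq_rpow_neg_one (hE : Module.finrank ℝ E < 4) :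
    MemLp (fun ξ : E ↦ ((1 + ‖ξ‖ ^ 2) ^ (-1 : ℝ) : ℝ)) 2 := by
  have hc : (fun ξ : E ↦ ((1 + ‖ξ‖ ^ 2) ^ (-1 : ℝ) : ℝ)).HasTemperateGrowth := by fun_prop
  rw [memLp_two_iff_integrable_sq hc.1.continuous.aestronglyMeasurable]
  refine (integrable_rpow_neg_one_add_norm_sq (E := E) (r := 4) (by exact_mod_cast hE)).congr ?_
  filter_upwards with ξ
  rw [← Real.rpow_mul_natCast (by positivity)]
  norm_num

/-- The Sobolev embedding `H² ⊂ L^∞`: Fourier inversion bounds the sup norm by the `L¹` norm of the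
transform, and Cauchy–Schwarz splits that into the `L²` norm of the symbol, finite in dimension
below 4, and Plancherel's `‖η‖₂`. -/
theorem exists_norm_schwartzResolvent_apply_le (hE : Module.finrank ℝ E < 4) :
    ∃ c : ℝ, 0 < c ∧ ∀ (η : 𝓢(E, ℂ)) (x : E), ‖schwartzResolvent η x‖ ≤ c * ‖η.toLp 2‖ := by
  have hm := memLp_two_one_add_sq_rpow_neg_one hE
  refine ⟨‖hm.toLp‖ + 1, by positivity, fun η x ↦ ?_⟩
  have h0 : ‖schwartzResolvent η x‖ ≤ ‖(𝓕 (schwartzResolvent η)).toLp 1‖ := by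
    have h := SchwartzMap.norm_fourier_apply_le_toLp_one (𝓕 (schwartzResolvent η)) (-x)
    have h' : 𝓕⁻ (𝓕 (schwartzResolvent η)) = schwartzResolvent η :=
      FourierTransform.fourierInv_fourier_eq _
    rw [SchwartzMap.fourierInv_apply_eq] at h'
    have h'' : schwartzResolvent η x = 𝓕 (𝓕 (schwartzResolvent η)) (-x) :=
      (DFunLike.congr_fun h' x).symm
    rw [h'']
    exact h
  refine h0.trans ?_
  have h1 : eLpNorm (𝓕 (schwartzResolvent η) : 𝓢(E, ℂ)) 1 volume
      ≤ eLpNorm (fun ξ : E ↦ ((1 + ‖ξ‖ ^ 2) ^ (-1 : ℝ) : ℝ)) 2 volume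
        * eLpNorm (𝓕 η : 𝓢(E, ℂ)) 2 volume := by
    have h2 : ((𝓕 (schwartzResolvent η) : 𝓢(E, ℂ)) : E → ℂ)
        = (fun ξ : E ↦ ((1 + ‖ξ‖ ^ 2) ^ (-1 : ℝ) : ℝ)) • ((𝓕 η : 𝓢(E, ℂ)) : E → ℂ) :=
      funext fun ξ ↦ fourier_schwartzResolvent_apply η ξ
    rw [h2]
    exact eLpNorm_smul_le_mul_eLpNorm (𝓕 η : 𝓢(E, ℂ)).continuous.aestronglyMeasurable hm.1
  have h3 := ENNReal.toReal_mono
    (ENNReal.mul_ne_top hm.2.ne ((𝓕 η : 𝓢(E, ℂ)).memLp 2 volume).2.ne) h1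
  rw [ENNReal.toReal_mul, ← SchwartzMap.norm_toLp, ← SchwartzMap.norm_toLp,
    SchwartzMap.norm_fourier_toL2_eq, ← Lp.norm_toLp _ hm] at h3
  refine h3.trans ?_
  gcongr
  linarith

end FourierMultiplier

/-! ### `L²` membership by duality -/

section Duality

variable {E : Type*} [NormedAddCommGroup E] [NormedSpace ℝ E] [FiniteDimensional ℝ E]
  [MeasurableSpace E] [BorelSpace E] {μ : Measure E} [μ.IsAddHaarMeasure]

/-- An integrable function that is bounded in `L²` norm as a functional on Schwartz functions
is in `L²`. -/
theorem eLpNorm_two_le_of_forall_schwartz {v : E → ℝ} (hv : Integrable v μ) {K : ℝ}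
    (hK : 0 ≤ K)
    (h : ∀ η : 𝓢(E, ℝ), |∫ x, η x * v x ∂μ| ≤ K * ‖η.toLp 2 μ‖) :
    eLpNorm v 2 μ ≤ ENNReal.ofReal K := by
  have hint (η : 𝓢(E, ℝ)) : Integrable (fun x ↦ η x * v x) μ := by
    obtain ⟨C, -, hC⟩ := η.decay 0 0
    refine hv.bdd_mul (c := C) η.continuous.aestronglyMeasurable (.of_forall fun x ↦ ?_)
    simpa using hC x
  let T : 𝓢(E, ℝ) →ₗ[ℝ] ℝ :=
    { toFun := fun η ↦ ∫ x, η x * v x ∂μ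
      map_add' := fun η ζ ↦ by
        simp only [_root_.add_apply, add_mul]
        exact integral_add (hint η) (hint ζ)
      map_smul' := fun c η ↦ by
        simp only [_root_.smul_apply, smul_eq_mul, mul_assoc, RingHom.id_apply]
        exact integral_const_mul _ _ }
  let e : 𝓢(E, ℝ) →ₗ[ℝ] Lp ℝ 2 μ := (SchwartzMap.toLpCLM ℝ ℝ 2 μ).toLinearMap
  have hd : DenseRange e := SchwartzMap.denseRange_toLpCLM (by simp)
  have hT : ∀ η, ‖T η‖ ≤ K * ‖e η‖ := h
  -- The functional extends to `L²` by density of Schwartz functions; `g` is its Riesz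
  -- representative, later identified with `v` by testing on compactly supported smooth functions.
  let g : Lp ℝ 2 μ := (InnerProductSpace.toDual ℝ (Lp ℝ 2 μ)).symm (T.extendOfNorm e)
  have hg : ‖g‖ ≤ K := by
    rw [LinearIsometryEquiv.norm_map]
    exact ContinuousLinearMap.opNorm_le_bound _ hK (LinearMap.norm_extendOfNorm_apply_le hd K hT)
  have hgη (η : 𝓢(E, ℝ)) : ∫ x, η x * v x ∂μ = ∫ x, η x * g x ∂μ := by
    have h1 : inner ℝ g (e η) = T η := by
      rw [InnerProductSpace.toDual_symm_apply, LinearMap.extendOfNorm_eq hd ⟨K, hT⟩]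
    rw [L2.inner_def] at h1
    change _ = ∫ x, η x * v x ∂μ at h1
    rw [← h1]
    apply integral_congr_ae
    filter_upwards [η.coeFn_toLp 2 μ] with x hx
    change inner ℝ (g x) (η.toLp 2 μ x) = _
    rw [hx]
    simp
  have hae : ∀ᵐ x ∂μ, v x = g x := by
    refine ae_eq_of_integral_contDiff_smul_eq hv.locallyIntegrable
      ((Lp.memLp g).locallyIntegrable (by norm_num)) fun φ hφ hc ↦ ?_
    exact hgη (hc.toSchwartzMap hφ)
  rw [eLpNorm_congr_ae hae, ← ENNReal.ofReal_toReal (Lp.eLpNorm_ne_top g), ← Lp.norm_def]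
  exact ENNReal.ofReal_le_ofReal hg

end Duality

/-! ### Product rule, scaling and commutator for the Laplacian -/

section LaplacianCalculus

variable {E : Type*} [NormedAddCommGroup E] [InnerProductSpace ℝ E] [FiniteDimensional ℝ E]

theorem laplacian_eq_sum_fderiv_fderiv {ι : Type*} [Fintype ι] (b : OrthonormalBasis ι ℝ E)
    {f : E → ℝ} (hf : ContDiff ℝ 2 f) (x : E) :
    Δ f x = ∑ i, fderiv ℝ (fun y ↦ fderiv ℝ f y (b i)) x (b i) := by
  rw [InnerProductSpace.laplacian_eq_iteratedFDeriv_orthonormalBasis f b]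
  refine Finset.sum_congr rfl fun i _ ↦ ?_
  have hd : DifferentiableAt ℝ (fderiv ℝ f) x :=
    (hf.fderiv_right (m := 1) (by norm_num)).differentiable (by norm_num) x
  rw [iteratedFDeriv_two_apply, fderiv_clm_apply hd (by fun_prop)]
  simp

theorem laplacian_mul {ι : Type*} [Fintype ι] (b : OrthonormalBasis ι ℝ E)
    {f g : E → ℝ} (hf : ContDiff ℝ 2 f) (hg : ContDiff ℝ 2 g) (x : E) :
    Δ (fun y ↦ f y * g y) x = f x * Δ g x
      + 2 * ∑ i, fderiv ℝ f x (b i) * fderiv ℝ g x (b i) + g x * Δ f x := by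
  have hf1 : Differentiable ℝ f := hf.differentiable (by norm_num)
  have hg1 : Differentiable ℝ g := hg.differentiable (by norm_num)
  have hf2 (i : ι) : Differentiable ℝ (fun y ↦ fderiv ℝ f y (b i)) :=
    ((hf.fderiv_right (m := 1) (by norm_num)).differentiable (by norm_num)).clm_apply
      (by fun_prop)
  have hg2 (i : ι) : Differentiable ℝ (fun y ↦ fderiv ℝ g y (b i)) :=
    ((hg.fderiv_right (m := 1) (by norm_num)).differentiable (by norm_num)).clm_apply
      (by fun_prop)
  rw [laplacian_eq_sum_fderiv_fderiv b (hf.mul hg), laplacian_eq_sum_fderiv_fderiv b hf,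
    laplacian_eq_sum_fderiv_fderiv b hg, Finset.mul_sum, Finset.mul_sum, Finset.mul_sum,
    ← Finset.sum_add_distrib, ← Finset.sum_add_distrib]
  refine Finset.sum_congr rfl fun i _ ↦ ?_
  have h1 : (fun y ↦ fderiv ℝ (fun z ↦ f z * g z) y (b i))
      = fun y ↦ f y * fderiv ℝ g y (b i) + g y * fderiv ℝ f y (b i) := by
    funext y
    rw [fderiv_fun_mul (hf1 y) (hg1 y)]
    simp
  rw [h1, fderiv_fun_add ((hf1 x).fun_mul (hg2 i x)) ((hg1 x).fun_mul (hf2 i x)),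
    fderiv_fun_mul (hf1 x) (hg2 i x), fderiv_fun_mul (hg1 x) (hf2 i x)]
  simp
  ring

theorem laplacian_comp_smul_sub {f : E → ℝ} (hf : ContDiff ℝ 2 f) (t : ℝ) (p x : E) :
    Δ (fun y ↦ f (t • (y - p))) x = t ^ 2 * Δ f (t • (x - p)) := by
  rw [InnerProductSpace.laplacian_eq_iteratedFDeriv_stdOrthonormalBasis,
    InnerProductSpace.laplacian_eq_iteratedFDeriv_stdOrthonormalBasis]
  simp only [Finset.mul_sum]
  refine Finset.sum_congr rfl fun i _ ↦ ?_
  rw [iteratedFDeriv_comp_sub (f := fun y ↦ f (t • y)), iteratedFDeriv_comp_const_smul t hf]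
  simp

/-- The commutator `[Δ, χ] φ = 2 ∇χ · ∇φ + φ Δχ`. -/
noncomputable def laplacianCommutator (χ φ : E → ℝ) (x : E) : ℝ :=
  2 * ∑ i, fderiv ℝ χ x (stdOrthonormalBasis ℝ E i) * fderiv ℝ φ x (stdOrthonormalBasis ℝ E i)
    + φ x * Δ χ x

/-- This confines the error term to the annulus, since the cutoff is locally constant on the inner
ball. -/
theorem laplacianCommutator_eq_zero_of_eventuallyEq_const {χ φ : E → ℝ} {x : E} {c : ℝ}
    (h : χ =ᶠ[nhds x] fun _ ↦ c) : laplacianCommutator χ φ x = 0 := by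
  have h1 : fderiv ℝ χ x = 0 := by
    rw [h.fderiv_eq]
    simp
  have h2 : Δ χ x = 0 := by
    rw [(InnerProductSpace.laplacian_congr_nhds h).eq_of_nhds]
    simp
  simp [laplacianCommutator, h1, h2]

theorem continuous_laplacian {f : E → ℝ} (hf : ContDiff ℝ 2 f) : Continuous (Δ f) := by
  rw [InnerProductSpace.laplacian_eq_iteratedFDeriv_stdOrthonormalBasis]
  refine continuous_finsetSum _ fun i _ ↦ ?_
  exact (ContinuousMultilinearMap.apply ℝ (fun _ : Fin 2 ↦ E) ℝ _).continuous.comp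
    (hf.continuous_iteratedFDeriv le_rfl)

theorem continuous_laplacianCommutator {χ φ : E → ℝ} (hχ : ContDiff ℝ ∞ χ)
    (hφ : ContDiff ℝ ∞ φ) : Continuous (laplacianCommutator χ φ) := by
  have h1 := hχ.continuous_fderiv (by simp)
  have h2 := hφ.continuous_fderiv (by simp)
  have h3 := hφ.continuous
  have h4 := continuous_laplacian (hχ.of_le (by norm_cast) : ContDiff ℝ 2 χ)
  unfold laplacianCommutator
  fun_prop

theorem tsupport_laplacian_subset (f : E → ℝ) : tsupport (Δ f) ⊆ tsupport f := by
  have h : Function.support (Δ f) ⊆ Function.support (iteratedFDeriv ℝ 2 f) := by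
    intro x hx h0
    apply hx
    simp [InnerProductSpace.laplacian_eq_iteratedFDeriv_stdOrthonormalBasis, h0]
  exact (closure_mono h).trans (tsupport_iteratedFDeriv_subset 2)

theorem HasCompactSupport.laplacian {f : E → ℝ} (hf : HasCompactSupport f) :
    HasCompactSupport (Δ f) :=
  hf.of_isClosed_subset (isClosed_tsupport _) (tsupport_laplacian_subset f)

end LaplacianCalculus

/-! ### Real-valued dual solutions and the commutator bound -/

section RealResolvent

variable {E : Type*} [NormedAddCommGroup E] [InnerProductSpace ℝ E] [FiniteDimensional ℝ E]
  [MeasurableSpace E] [BorelSpace E]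

/-- Regard `η` as complex-valued, apply the resolvent and take the real part, which commutes with
derivatives and does not increase norms. -/
theorem exists_real_schwartzResolvent (hE : Module.finrank ℝ E < 4) :
    ∃ c : ℝ, 0 < c ∧ ∀ η : 𝓢(E, ℝ), ∃ φ : 𝓢(E, ℝ),
      (∀ x, Δ (φ : E → ℝ) x = (2 * Real.pi) ^ 2 * (φ x - η x)) ∧
      (∀ x, |φ x| ≤ c * ‖η.toLp 2‖) ∧
      ‖φ.toLp 2‖ ≤ ‖η.toLp 2‖ ∧
      ∀ m : E, ‖(∂_{m} φ).toLp 2‖ ≤ 2 * Real.pi * ‖m‖ * ‖η.toLp 2‖ := by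
  obtain ⟨c, hc, hbound⟩ := exists_norm_schwartzResolvent_apply_le hE
  refine ⟨c, hc, fun η ↦ ?_⟩
  set ζ : 𝓢(E, ℂ) := η.postcompCLM Complex.ofRealCLM with hζ
  have hζη : ‖ζ.toLp 2‖ = ‖η.toLp 2‖ := by
    rw [SchwartzMap.norm_toLp, SchwartzMap.norm_toLp]
    congr 1
    apply eLpNorm_congr_norm_ae
    filter_upwards with x
    simp [hζ]
  set Φ := schwartzResolvent ζ with hΦ
  have hre (Ψ : 𝓢(E, ℂ)) : ‖(Ψ.postcompCLM Complex.reCLM).toLp 2‖ ≤ ‖Ψ.toLp 2‖ := by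
    apply Lp.norm_le_norm_of_ae_le
    filter_upwards [Ψ.coeFn_toLp 2, (Ψ.postcompCLM Complex.reCLM).coeFn_toLp 2] with x h1 h2
    rw [h1, h2]
    simpa using Complex.abs_re_le_norm (Ψ x)
  refine ⟨Φ.postcompCLM Complex.reCLM, fun x ↦ ?_, fun x ↦ ?_, ?_, fun m ↦ ?_⟩
  · have h1 : ((Φ.postcompCLM Complex.reCLM : 𝓢(E, ℝ)) : E → ℝ) = Complex.reCLM ∘ Φ := rfl
    rw [h1, ContDiffAt.laplacian_CLM_comp_left (Φ.smooth 2).contDiffAt]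
    have h2 := DFunLike.congr_fun (laplacian_schwartzResolvent ζ) x
    rw [SchwartzMap.laplacian_apply] at h2
    rw [Function.comp_apply, h2]
    rw [_root_.smul_apply, _root_.sub_apply, map_smul, map_sub, smul_eq_mul]
    rfl
  · rw [← hζη]
    simpa using (Complex.abs_re_le_norm (Φ x)).trans (hbound ζ x)
  · rw [← hζη]
    exact (hre Φ).trans (norm_toLp_schwartzResolvent_le ζ)
  · have h1 : ∂_{m} (Φ.postcompCLM Complex.reCLM) = (∂_{m} Φ).postcompCLM Complex.reCLM := by
      ext x
      rw [SchwartzMap.lineDerivOp_apply_eq_fderiv, SchwartzMap.postcompCLM_apply,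
        SchwartzMap.lineDerivOp_apply_eq_fderiv]
      have h2 : ((Φ.postcompCLM Complex.reCLM : 𝓢(E, ℝ)) : E → ℝ) = Complex.reCLM ∘ Φ := rfl
      rw [h2, (Complex.reCLM.hasFDerivAt.comp x (Φ.hasFDerivAt x)).fderiv]
      rfl
    rw [h1, ← hζη]
    exact (hre _).trans (norm_toLp_lineDeriv_schwartzResolvent_le ζ m)

/-- The commutator is of first order in `φ`, with coefficients bounded because `χ` is smooth with
compact support. -/
theorem exists_eLpNorm_laplacianCommutator_le {χ : E → ℝ} (hχ : ContDiff ℝ ∞ χ)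
    (hc : HasCompactSupport χ) :
    ∃ B : ℝ, 0 < B ∧ ∀ (φ : 𝓢(E, ℝ)) (N : ℝ), ‖φ.toLp 2‖ ≤ N →
      (∀ m : E, ‖(∂_{m} φ).toLp 2‖ ≤ 2 * Real.pi * ‖m‖ * N) →
      eLpNorm (laplacianCommutator χ φ) 2 volume ≤ ENNReal.ofReal (B * N) := by
  obtain ⟨B₁, hB₁⟩ := (hχ.continuous_fderiv (by simp)).bounded_above_of_compact_support
    (hc.fderiv (𝕜 := ℝ))
  obtain ⟨B₂, hB₂⟩ :=
    (continuous_laplacian (hχ.of_le (by norm_cast))).bounded_above_of_compact_support hc.laplacian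
  have hB₁0 : 0 ≤ B₁ := (norm_nonneg _).trans (hB₁ 0)
  have hB₂0 : 0 ≤ B₂ := (norm_nonneg _).trans (hB₂ 0)
  set b := stdOrthonormalBasis ℝ E
  refine ⟨Module.finrank ℝ E * (2 * B₁ * (2 * Real.pi)) + B₂ + 1, by positivity,
    fun φ N hφ hdφ ↦ ?_⟩
  have hN : 0 ≤ N := (norm_nonneg _).trans hφ
  have hLp {ψ : 𝓢(E, ℝ)} {c : ℝ} (h : ‖ψ.toLp 2‖ ≤ c) :
      eLpNorm ψ 2 volume ≤ ENNReal.ofReal c := by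
    rw [← ENNReal.ofReal_toReal (ψ.memLp 2 volume).2.ne, ← SchwartzMap.norm_toLp]
    exact ENNReal.ofReal_le_ofReal h
  have hterm (i) : eLpNorm (fun x ↦ 2 * (fderiv ℝ χ x (b i) * fderiv ℝ φ x (b i))) 2 volume
      ≤ ENNReal.ofReal (2 * B₁ * (2 * Real.pi) * N) := by
    have h1 := eLpNorm_le_mul_eLpNorm_of_ae_le_mul (μ := volume) (p := 2) (c := 2 * B₁)
      (f := fun x ↦ 2 * (fderiv ℝ χ x (b i) * fderiv ℝ φ x (b i))) (g := (∂_{b i} φ : 𝓢(E, ℝ)))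
      (.of_forall fun x ↦ by
        have h2 : ‖fderiv ℝ χ x (b i)‖ ≤ B₁ := by
          simpa using ((fderiv ℝ χ x).le_opNorm (b i)).trans
            (mul_le_mul_of_nonneg_right (hB₁ x) (norm_nonneg _))
        rw [SchwartzMap.lineDerivOp_apply_eq_fderiv, norm_mul, norm_mul, Real.norm_two, mul_assoc]
        gcongr)
    refine h1.trans ?_
    have h3 := hdφ (b i)
    rw [b.norm_eq_one, mul_one] at h3
    rw [mul_assoc (2 * B₁), ENNReal.ofReal_mul (by positivity : 0 ≤ 2 * B₁)]
    gcongr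
    exact hLp h3
  have hlast : eLpNorm (fun x ↦ φ x * Δ χ x) 2 volume ≤ ENNReal.ofReal (B₂ * N) := by
    have h1 := eLpNorm_le_mul_eLpNorm_of_ae_le_mul (μ := volume) (p := 2) (c := B₂)
      (f := fun x ↦ φ x * Δ χ x) (g := φ)
      (.of_forall fun x ↦ by
        rw [norm_mul, mul_comm]
        gcongr
        exact hB₂ x)
    refine h1.trans ?_
    rw [ENNReal.ofReal_mul hB₂0]
    gcongr
    exact hLp hφ
  have hmχ (i) : Continuous fun x ↦ 2 * (fderiv ℝ χ x (b i) * fderiv ℝ φ x (b i)) := by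
    have := hχ.continuous_fderiv (by simp)
    have := (φ.smooth 1).continuous_fderiv (by simp)
    fun_prop
  have heq : laplacianCommutator χ φ
      = (∑ i, fun x ↦ 2 * (fderiv ℝ χ x (b i) * fderiv ℝ φ x (b i))) + fun x ↦ φ x * Δ χ x := by
    funext x
    simp [laplacianCommutator, Finset.mul_sum, b]
  rw [heq]
  calc _ ≤ (∑ i, eLpNorm (fun x ↦ 2 * (fderiv ℝ χ x (b i) * fderiv ℝ φ x (b i))) 2 volume)
        + eLpNorm (fun x ↦ φ x * Δ χ x) 2 volume := by
        refine (eLpNorm_add_le ?_ ?_ (by norm_num)).trans ?_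
        · exact Finset.aestronglyMeasurable_sum _ fun i _ ↦ (hmχ i).aestronglyMeasurable
        · exact (φ.continuous.mul
            (continuous_laplacian (hχ.of_le (by norm_cast)))).aestronglyMeasurable
        · gcongr
          exact eLpNorm_sum_le (fun i _ ↦ (hmχ i).aestronglyMeasurable) (by norm_num)
    _ ≤ (∑ _i : Fin (Module.finrank ℝ E), ENNReal.ofReal (2 * B₁ * (2 * Real.pi) * N))
        + ENNReal.ofReal (B₂ * N) := by
        gcongr with i
        exact hterm i
    _ = ENNReal.ofReal (Module.finrank ℝ E * (2 * B₁ * (2 * Real.pi) * N) + B₂ * N) := by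
        rw [ENNReal.ofReal_add (by positivity) (by positivity),
          ENNReal.ofReal_mul (by positivity : (0 : ℝ) ≤ Module.finrank ℝ E)]
        simp
    _ ≤ _ := by
        apply ENNReal.ofReal_le_ofReal
        nlinarith

end RealResolvent

/-! ### Integrability and `L²` pairings -/

theorem integrable_mul_of_locallyIntegrableOn {X : Type*} [TopologicalSpace X]
    [T2Space X] [MeasurableSpace X]
    [OpensMeasurableSpace X] {μ : Measure X} {Ω : Set X} {u g : X → ℝ}
    (hu : LocallyIntegrableOn u Ω μ) (hg : Continuous g) (hc : HasCompactSupport g)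
    (hsub : tsupport g ⊆ Ω) : Integrable (fun x ↦ u x * g x) μ := by
  have h := (hu.integrableOn_compact_subset hsub hc).mul_continuousOn hg.continuousOn hc
  rwa [integrableOn_iff_integrable_of_support_subset] at h
  intro x hx
  exact subset_tsupport _ (right_ne_zero_of_mul hx)

theorem eLpNorm_two_sq_eq_lintegral {X : Type*} [MeasurableSpace X] {μ : Measure X} (f : X → ℝ) :
    eLpNorm f 2 μ ^ 2 = ∫⁻ x, ‖f x‖ₑ ^ 2 ∂μ := by
  have h := eLpNorm_nnreal_pow_eq_lintegral (μ := μ) (f := f) (p := 2) (by norm_num)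
  simpa using h

theorem abs_integral_mul_le_eLpNorm_mul_eLpNorm {X : Type*} [MeasurableSpace X] {μ : Measure X}
    {f g : X → ℝ} (hf : MemLp f 2 μ) (hg : MemLp g 2 μ) :
    |∫ x, f x * g x ∂μ| ≤ (eLpNorm f 2 μ).toReal * (eLpNorm g 2 μ).toReal := by
  rw [← ENNReal.toReal_mul, ← Real.norm_eq_abs, ← toReal_enorm]
  refine ENNReal.toReal_mono (ENNReal.mul_ne_top hf.2.ne hg.2.ne) ?_
  refine (enorm_integral_le_lintegral_enorm _).trans ?_
  rw [← eLpNorm_one_eq_lintegral_enorm]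
  exact eLpNorm_smul_le_mul_eLpNorm (p := 2) (q := 2) (r := 1) (φ := f) hg.1 hf.1

/-! ### The estimate at unit scale -/

/-- Test the equation against `χ φ` and expand `Δ(χ φ) = κ χ (φ - η) + [Δ, χ] φ`. All derivatives
fall on the test function, so no regularity of `u` is needed. -/
theorem IsSchrodingerSolutionOn.integral_mul_cutoff {Ω : Set Plane}
    {W u χ : Plane → ℝ} (hW : AEStronglyMeasurable W (volume.restrict Ω))
    (hW1 : ∀ᵐ x ∂volume.restrict Ω, |W x| ≤ 1)
    (hu : IsSchrodingerSolutionOn 1 0 W u Ω) (hχ : ContDiff ℝ ∞ χ) (hc : HasCompactSupport χ)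
    (hsub : tsupport χ ⊆ Ω) {κ : ℝ} (η φ : 𝓢(Plane, ℝ))
    (hφ : ∀ x, Δ (φ : Plane → ℝ) x = κ * (φ x - η x)) :
    κ * ∫ x, η x * (χ x * u x) =
      (∫ x in Ω, ((κ - W x) * φ x) * (χ x * u x)) + ∫ x in Ω, u x * laplacianCommutator χ φ x := by
  have hprod : ContDiff ℝ ∞ (fun x ↦ χ x * φ x) := hχ.mul φ.smooth'
  have hpc : HasCompactSupport (fun x ↦ χ x * φ x) := hc.mul_right
  have hps : tsupport (fun x ↦ χ x * φ x) ⊆ Ω := tsupport_mul_subset_left.trans hsub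
  have hv : Integrable (fun x ↦ χ x * u x) := by
    simpa only [mul_comm] using
      integrable_mul_of_locallyIntegrableOn hu.locallyIntegrableOn hχ.continuous hc hsub
  have hbdd (ψ : 𝓢(Plane, ℝ)) : Integrable (fun x ↦ ψ x * (χ x * u x)) := by
    obtain ⟨C, -, hC⟩ := ψ.decay 0 0
    exact hv.bdd_mul (c := C) ψ.continuous.aestronglyMeasurable
      (.of_forall fun x ↦ by simpa using hC x)
  have hη := (hbdd η).integrableOn (s := Ω)
  have hφi := (hbdd φ).integrableOn (s := Ω)
  have hWφ : IntegrableOn (fun x ↦ W x * (φ x * (χ x * u x))) Ω :=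
    hφi.bdd_mul (c := 1) hW (by simpa using hW1)
  have hL : IntegrableOn (fun x ↦ u x * Δ (fun y ↦ χ y * φ y) x) Ω :=
    (integrable_mul_of_locallyIntegrableOn hu.locallyIntegrableOn
      (continuous_laplacian (hprod.of_le (by norm_cast))) hpc.laplacian
      ((tsupport_laplacian_subset _).trans hps)).integrableOn
  have h0 := hu.integral_eq_zero _ hprod hpc hps
  have h1 : ∫ x in Ω, u x * Δ (fun y ↦ χ y * φ y) x
      = ∫ x in Ω, W x * (φ x * (χ x * u x)) := by
    rw [← sub_eq_zero, ← integral_sub hL hWφ, ← neg_eq_zero, ← integral_neg]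
    convert h0 using 3
    ring
  have h2 : ∫ x, η x * (χ x * u x) = ∫ x in Ω, η x * (χ x * u x) := by
    symm
    apply setIntegral_eq_integral_of_forall_compl_eq_zero
    intro x hx
    rw [image_eq_zero_of_notMem_tsupport (fun h ↦ hx (hsub h))]
    simp
  have h3 : ∫ x in Ω, ((κ - W x) * φ x) * (χ x * u x)
      = κ * (∫ x in Ω, φ x * (χ x * u x)) - ∫ x in Ω, W x * (φ x * (χ x * u x)) := by
    rw [← integral_const_mul, ← integral_sub (hφi.const_mul κ) hWφ]
    congr 1 with x
    ring
  have h4 : ∫ x in Ω, u x * laplacianCommutator χ φ x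
      = (∫ x in Ω, u x * Δ (fun y ↦ χ y * φ y) x)
        - (κ * (∫ x in Ω, φ x * (χ x * u x)) - κ * ∫ x in Ω, η x * (χ x * u x)) := by
    rw [← integral_const_mul, ← integral_const_mul,
      ← integral_sub (hφi.const_mul κ) (hη.const_mul κ),
      ← integral_sub hL (by exact (hφi.const_mul κ).sub (hη.const_mul κ))]
    congr 1 with x
    rw [laplacian_mul (stdOrthonormalBasis ℝ Plane) (hχ.of_le (by norm_cast)) (φ.smooth 2), hφ,
      laplacianCommutator]
    ring
  rw [h2, h3, h4, h1]
  ring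

theorem measure_ball_rpow_half_le {ρ : ℝ} (hρ : 0 < ρ) :
    (volume.restrict (Metric.ball (0 : Plane) (2 * ρ)) Set.univ)
      ^ (1 / (1 : ℝ≥0∞).toReal - 1 / (2 : ℝ≥0∞).toReal) ≤ ENNReal.ofReal (4 * ρ) := by
  have h1 : volume (Metric.ball (0 : Plane) (2 * ρ)) ≤ ENNReal.ofReal (4 * ρ) ^ 2 := by
    -- The area `4πρ²` is at most `(4ρ)²`, as `π ≤ 4`.
    rw [EuclideanSpace.volume_ball_fin_two, ← ENNReal.ofReal_pow (by positivity),
      ← ENNReal.ofReal_pow (by positivity),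
      ← ENNReal.ofReal_mul (by positivity)]
    apply ENNReal.ofReal_le_ofReal
    nlinarith [Real.pi_le_four, sq_nonneg ρ]
  rw [Measure.restrict_apply_univ]
  refine (ENNReal.rpow_le_rpow h1 (by norm_num)).trans_eq ?_
  rw [← ENNReal.rpow_natCast, ← ENNReal.rpow_mul]
  norm_num

/-- For the unit-scale equation `Δu = W u` with `|W| ≤ 1`, the `L²` mass in a sufficiently small
disc is controlled by the mass in the surrounding annulus. -/
theorem exists_ball_lintegral_le_annulus :
    ∃ ρ : ℝ, 0 < ρ ∧ ∃ C : ℝ, 0 < C ∧ ∀ W u : Plane → ℝ,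
      AEStronglyMeasurable W (volume.restrict (Metric.ball 0 (2 * ρ))) →
      (∀ᵐ x ∂volume.restrict (Metric.ball 0 (2 * ρ)), |W x| ≤ 1) →
      IsSchrodingerSolutionOn 1 0 W u (Metric.ball 0 (2 * ρ)) →
      ∫⁻ x in Metric.ball 0 ρ, ‖u x‖ₑ ^ 2 ≤
        ENNReal.ofReal C * ∫⁻ x in Metric.ball 0 (2 * ρ) \ Metric.ball 0 ρ, ‖u x‖ₑ ^ 2 := by
  obtain ⟨c, hc, hres⟩ := exists_real_schwartzResolvent (E := Plane) (by simp)
  -- Chosen so that `2c · 4ρ = 1/2`, the factor needed for absorption.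
  set ρ : ℝ := 1 / (16 * c) with hρdef
  have hρ : 0 < ρ := by positivity
  have hcρ : 8 * c * ρ = 1 / 2 := by
    rw [hρdef]
    field_simp
    norm_num
  let f : ContDiffBump (0 : Plane) := ⟨ρ, 3 / 2 * ρ, hρ, by linarith⟩
  have hχ : ContDiff ℝ ∞ f := f.contDiff
  have hχc : HasCompactSupport f := f.hasCompactSupport
  have hχs : tsupport f ⊆ Metric.ball 0 (2 * ρ) := by
    rw [f.tsupport_eq]
    exact Metric.closedBall_subset_ball (by change 3 / 2 * ρ < 2 * ρ; linarith)
  have hχ1 : ∀ x ∈ Metric.ball (0 : Plane) ρ, f =ᶠ[nhds x] fun _ ↦ 1 := fun x hx ↦ by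
    filter_upwards [Metric.isOpen_ball.mem_nhds hx] with y hy
    exact f.one_of_mem_closedBall (Metric.ball_subset_closedBall hy)
  obtain ⟨B, hB, hcomm⟩ := exists_eLpNorm_laplacianCommutator_le hχ hχc
  refine ⟨ρ, hρ, (2 * B) ^ 2, by positivity, fun W u hW hW1 hu ↦ ?_⟩
  set Ω : Set Plane := Metric.ball 0 (2 * ρ) with hΩ
  set A : Set Plane := Ω \ Metric.ball 0 ρ with hA
  have hum : AEStronglyMeasurable u (volume.restrict Ω) :=
    hu.locallyIntegrableOn.aestronglyMeasurable
  have huA : AEStronglyMeasurable u (volume.restrict A) :=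
    hum.mono_measure (Measure.restrict_mono Set.sdiff_subset le_rfl)
  rw [← eLpNorm_two_sq_eq_lintegral (μ := volume.restrict A)]
  by_cases htop : eLpNorm u 2 (volume.restrict A) = ⊤
  · rw [htop, ENNReal.top_pow two_ne_zero, ENNReal.mul_top (by simpa using hB.ne')]
    exact le_top
  set v : Plane → ℝ := fun x ↦ f x * u x with hvdef
  have hv : Integrable v := by
    simpa only [mul_comm, hvdef] using
      integrable_mul_of_locallyIntegrableOn hu.locallyIntegrableOn hχ.continuous hχc hχs
  set a₁ : ℝ := ∫ x, ‖v x‖ with ha₁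
  set α : ℝ := (eLpNorm u 2 (volume.restrict A)).toReal with hα
  have ha₁0 : 0 ≤ a₁ := integral_nonneg fun _ ↦ norm_nonneg _
  have hα0 : 0 ≤ α := ENNReal.toReal_nonneg
  have hκ : 1 ≤ (2 * Real.pi) ^ 2 := by nlinarith [Real.pi_gt_three]
  have hdual : ∀ η : 𝓢(Plane, ℝ), |∫ x, η x * v x| ≤ (2 * c * a₁ + B * α) * ‖η.toLp 2‖ := by
    intro η
    obtain ⟨φ, hφ, hφc, hφ2, hdφ⟩ := hres η
    set N := ‖η.toLp 2 volume‖ with hN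
    have hN0 : 0 ≤ N := norm_nonneg _
    have hid := hu.integral_mul_cutoff hW hW1 hχ hχc hχs η φ hφ
    set κ : ℝ := (2 * Real.pi) ^ 2
    have h1 : |∫ x in Ω, ((κ - W x) * φ x) * (f x * u x)| ≤ (2 * κ * (c * N)) * a₁ := by
      rw [ha₁, ← integral_const_mul, ← Real.norm_eq_abs]
      refine (norm_integral_le_of_norm_le (g := fun x ↦ 2 * κ * (c * N) * ‖v x‖)
        (hv.norm.const_mul _).integrableOn ?_).trans
        (setIntegral_le_integral (hv.norm.const_mul _)
          (.of_forall fun x ↦ by positivity))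
      filter_upwards [hW1] with x hx
      rw [norm_mul, norm_mul]
      have h2 : ‖κ - W x‖ ≤ 2 * κ := by
        rw [Real.norm_eq_abs, abs_le]
        constructor <;> linarith [abs_le.mp hx]
      gcongr
      exact hφc x
    have hG := hcomm φ N hφ2 hdφ
    have h3 : |∫ x in Ω, u x * laplacianCommutator f φ x| ≤ α * (B * N) := by
      have h4 : ∫ x in Ω, u x * laplacianCommutator f φ x
          = ∫ x in A, u x * laplacianCommutator f φ x := by
        apply setIntegral_eq_of_subset_of_forall_sdiff_eq_zero measurableSet_ball Set.sdiff_subset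
        intro x hx
        have hxb : x ∈ Metric.ball (0 : Plane) ρ := by
          by_contra hn
          exact hx.2 ⟨hx.1, hn⟩
        rw [laplacianCommutator_eq_zero_of_eventuallyEq_const (hχ1 x hxb), mul_zero]
      have h5 : eLpNorm (laplacianCommutator f φ) 2 (volume.restrict A) ≤ ENNReal.ofReal (B * N) :=
        (eLpNorm_mono_measure _ Measure.restrict_le_self).trans hG
      have hGm : MemLp (laplacianCommutator f φ) 2 (volume.restrict A) :=
        ⟨(continuous_laplacianCommutator hχ φ.smooth').aestronglyMeasurable,
          h5.trans_lt ENNReal.ofReal_lt_top⟩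
      rw [h4]
      refine (abs_integral_mul_le_eLpNorm_mul_eLpNorm ⟨huA, lt_top_iff_ne_top.2 htop⟩ hGm).trans ?_
      gcongr
      exact ENNReal.toReal_le_of_le_ofReal (by positivity) h5
    have h6 : κ * |∫ x, η x * v x| ≤ κ * ((2 * c * a₁ + B * α) * N) := by
      calc κ * |∫ x, η x * v x| = |κ * ∫ x, η x * v x| := by
            rw [abs_mul, abs_of_nonneg (by linarith : 0 ≤ κ)]
        _ ≤ (2 * κ * (c * N)) * a₁ + α * (B * N) := by
            rw [hid]
            exact (abs_add_le _ _).trans (add_le_add h1 h3)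
        -- `κ ≥ 1` allows a factor `κ` on the second term, so that `κ` cancels.
        _ ≤ (2 * κ * (c * N)) * a₁ + κ * (α * (B * N)) := by
            have h7 : 0 ≤ α * (B * N) := by positivity
            linarith [le_mul_of_one_le_left h7 hκ]
        _ = _ := by ring
    exact le_of_mul_le_mul_left h6 (by linarith)
  have hv2 := eLpNorm_two_le_of_forall_schwartz hv (by positivity) hdual
  -- Duality has made `‖v‖₂` finite, without which the absorption below would be void.
  have hv2top : eLpNorm v 2 volume ≠ ⊤ := (hv2.trans_lt ENNReal.ofReal_lt_top).ne
  set n : ℝ := (eLpNorm v 2 volume).toReal with hn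
  have hnK : n ≤ 2 * c * a₁ + B * α := ENNReal.toReal_le_of_le_ofReal (by positivity) hv2
  have ha₁n : a₁ ≤ 4 * ρ * n := by
    have h1 : eLpNorm v 1 volume ≤ eLpNorm v 2 volume * ENNReal.ofReal (4 * ρ) := by
      have hsupp : Function.support v ⊆ Ω := fun x hx ↦
        hχs (subset_tsupport _ (left_ne_zero_of_mul hx))
      rw [← eLpNorm_restrict_eq_of_support_subset hsupp,
        ← eLpNorm_restrict_eq_of_support_subset (p := 2) hsupp]
      refine (eLpNorm_le_eLpNorm_mul_rpow_measure_univ (q := 2) (by norm_num)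
        hv.1.restrict).trans ?_
      gcongr
      exact measure_ball_rpow_half_le hρ
    rw [ha₁, integral_norm_eq_lintegral_enorm hv.1, ← eLpNorm_one_eq_lintegral_enorm, mul_comm]
    refine (ENNReal.toReal_mono (ENNReal.mul_ne_top hv2top ENNReal.ofReal_ne_top) h1).trans ?_
    rw [ENNReal.toReal_mul, ENNReal.toReal_ofReal (by positivity)]
  -- Absorption: `n ≤ 2c · 4ρ n + B α = n / 2 + B α`.
  have hn2 : n ≤ 2 * B * α := by nlinarith
  calc ∫⁻ x in Metric.ball 0 ρ, ‖u x‖ₑ ^ 2 = ∫⁻ x in Metric.ball 0 ρ, ‖v x‖ₑ ^ 2 := by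
        refine setLIntegral_congr_fun measurableSet_ball fun x hx ↦ ?_
        simp only [hvdef, (hχ1 x hx).eq_of_nhds, one_mul]
    _ ≤ ∫⁻ x, ‖v x‖ₑ ^ 2 := setLIntegral_le_lintegral _ _
    _ = eLpNorm v 2 volume ^ 2 := (eLpNorm_two_sq_eq_lintegral v).symm
    _ ≤ (ENNReal.ofReal (2 * B) * eLpNorm u 2 (volume.restrict A)) ^ 2 := by
        gcongr
        rw [← ENNReal.ofReal_toReal hv2top, ← ENNReal.ofReal_toReal htop,
          ← ENNReal.ofReal_mul (by positivity)]
        exact ENNReal.ofReal_le_ofReal hn2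
    _ = ENNReal.ofReal ((2 * B) ^ 2) * eLpNorm u 2 (volume.restrict A) ^ 2 := by
        rw [mul_pow, ENNReal.ofReal_pow (by positivity)]

/-! ### Affine change of variables -/

section Rescaling

/-- The affine map `y ↦ p + s y` of the plane. -/
noncomputable def affineScaling (p : Plane) {s : ℝ} (hs : s ≠ 0) : Plane ≃ₜ Plane :=
  (Homeomorph.smulOfNeZero s hs).trans (Homeomorph.addLeft p)

theorem affineScaling_apply (p : Plane) {s : ℝ} (hs : s ≠ 0) (y : Plane) :
    affineScaling p hs y = p + s • y := rfl

theorem map_affineScaling_volume (p : Plane) {s : ℝ} (hs : s ≠ 0) :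
    Measure.map (affineScaling p hs) volume
      = ENNReal.ofReal (s ^ 2)⁻¹ • (volume : Measure Plane) := by
  have h1 : (affineScaling p hs : Plane → Plane) = (fun x ↦ p + x) ∘ (fun y ↦ s • y) := rfl
  rw [h1, ← Measure.map_map (by fun_prop) (by fun_prop), Measure.map_addHaar_smul volume hs,
    Measure.map_smul, map_add_left_eq_self]
  simp [abs_inv]

theorem preimage_affineScaling_ball (p : Plane) {s : ℝ} (hs : 0 < s) (R : ℝ) :
    affineScaling p hs.ne' ⁻¹' Metric.ball p (s * R) = Metric.ball 0 R := by
  ext y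
  simp [affineScaling_apply, norm_smul, abs_of_pos hs, hs]

theorem map_affineScaling_restrict (p : Plane) {s : ℝ} (hs : s ≠ 0) {S : Set Plane} :
    Measure.map (affineScaling p hs) (volume.restrict (affineScaling p hs ⁻¹' S))
      = ENNReal.ofReal (s ^ 2)⁻¹ • (volume : Measure Plane).restrict S := by
  rw [← (affineScaling p hs).measurableEmbedding.restrict_map, map_affineScaling_volume,
    Measure.restrict_smul]

/-- Transport each test function back by the inverse map. The chain rule gives `Δ` a factor `s⁻²`,
so dividing the equation by `h² / s²` normalises it. -/
theorem IsSchrodingerSolutionOn.comp_affineScaling {h E : ℝ} (hh : h ≠ 0) {V u : Plane → ℝ}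
    {Ω : Set Plane} (hΩ : IsOpen Ω) (hu : IsSchrodingerSolutionOn h E V u Ω) (p : Plane) {s : ℝ}
    (hs : s ≠ 0) :
    IsSchrodingerSolutionOn 1 0 (fun y ↦ s ^ 2 / h ^ 2 * (V (affineScaling p hs y) - E))
      (fun y ↦ u (affineScaling p hs y)) (affineScaling p hs ⁻¹' Ω) := by
  set T := affineScaling p hs with hT
  have hTe := T.measurableEmbedding
  refine ⟨?_, fun ψ hψ hc hsub ↦ ?_⟩
  · rw [locallyIntegrableOn_iff (hΩ.preimage T.continuous).isLocallyClosed]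
    intro K hK hKc
    have h1 : IntegrableOn u (T '' K) :=
      hu.locallyIntegrableOn.integrableOn_compact_subset
        (Set.image_subset_iff.2 hK) (hKc.image T.continuous)
    have h2 : IntegrableOn u (T '' K) (Measure.map T volume) := by
      rw [hT, map_affineScaling_volume, IntegrableOn, Measure.restrict_smul]
      exact h1.integrable.smul_measure ENNReal.ofReal_ne_top
    rw [hTe.integrableOn_map_iff, T.injective.preimage_image] at h2
    exact h2
  · set φ : Plane → ℝ := fun x ↦ ψ (s⁻¹ • (x - p)) with hφ
    have hTs : (T.symm : Plane → Plane) = fun x ↦ s⁻¹ • (x - p) := by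
      funext x
      rw [T.symm_apply_eq, hT, affineScaling_apply, smul_inv_smul₀ hs]
      abel
    have hφT : φ = ψ ∘ T.symm := by
      rw [hTs]
      rfl
    have hφ1 : ContDiff ℝ ∞ φ := by
      fun_prop
    have hφ2 : HasCompactSupport φ := by
      rw [hφT]
      exact hc.comp_homeomorph T.symm
    have hφ3 : tsupport φ ⊆ Ω := by
      rw [hφT, tsupport_comp_eq_preimage]
      intro x hx
      simpa using hsub hx
    have h0 := hu.integral_eq_zero φ hφ1 hφ2 hφ3
    have h1 : ∫ y in T ⁻¹' Ω, u (T y) * (-h ^ 2 * Δ φ (T y) + (V (T y) - E) * φ (T y)) = 0 := by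
      have h2 := hTe.integral_map (μ := volume.restrict (T ⁻¹' Ω))
        (fun x ↦ u x * (-h ^ 2 * Δ φ x + (V x - E) * φ x))
      rw [← h2, hT, map_affineScaling_restrict, integral_smul_measure, h0, smul_zero]
    have h3 : ∀ y, u (T y) * (-1 ^ 2 * Δ ψ y + (s ^ 2 / h ^ 2 * (V (T y) - E) - 0) * ψ y)
        = s ^ 2 / h ^ 2 * (u (T y) * (-h ^ 2 * Δ φ (T y) + (V (T y) - E) * φ (T y))) := by
      intro y
      have h4 : s⁻¹ • (T y - p) = y := by
        rw [hT, affineScaling_apply, add_sub_cancel_left, inv_smul_smul₀ hs]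
      rw [hφ, laplacian_comp_smul_sub (hψ.of_le (by norm_cast))]
      simp only [h4]
      field_simp
      ring
    simp_rw [h3]
    rw [integral_const_mul, h1, mul_zero]

theorem lintegral_comp_affineScaling (p : Plane) {s : ℝ} (hs : s ≠ 0) (S : Set Plane)
    (f : Plane → ℝ≥0∞) :
    ∫⁻ y in affineScaling p hs ⁻¹' S, f (affineScaling p hs y)
      = ENNReal.ofReal (s ^ 2)⁻¹ * ∫⁻ x in S, f x := by
  rw [← (affineScaling p hs).measurableEmbedding.lintegral_map, map_affineScaling_restrict,
    lintegral_smul_measure, smul_eq_mul]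

end Rescaling

/-! ### Conclusion for small `h` -/

theorem tendsto_shrinkParam (c : ℝ) {R₀ : ℝ} (hR₀ : 0 < R₀) :
    Filter.Tendsto (shrinkParam c R₀) (nhdsWithin 0 (Set.Ioi 0)) (nhds 0) := by
  unfold shrinkParam
  have h : Filter.Tendsto (fun h ↦ R₀ / h) (nhdsWithin 0 (Set.Ioi 0)) Filter.atTop := by
    simp_rw [div_eq_mul_inv]
    exact tendsto_inv_nhdsGT_zero.const_mul_atTop hR₀
  exact (Real.tendsto_log_atTop.comp h).const_div_atTop c

theorem mainTheorem3
    (I : Set ℝ) (hI : IsCompact I) (M : ℝ≥0)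
    (c R₀ : ℝ) (hc : 0 < c) (hR₀ : 0 < R₀)
    (a b : ℝ) (ha : 0 < a) (hab : a ≤ b) :
    ∃ C₀ : ℝ, 0 < C₀ ∧ ∃ h₀ : ℝ, 0 < h₀ ∧
      ∀ h : ℝ, 0 < h → h < h₀ →
      ∀ E ∈ I, ∀ (p : Plane) (r : ℝ),
        a * (h * shrinkParam c R₀ h) ≤ 2 * r → 2 * r ≤ b * (h * shrinkParam c R₀ h) →
      ∀ V : Plane → ℝ,
        MemLp V ∞ (volume.restrict (Metric.ball p (2 * r))) →
        eLpNorm V ∞ (volume.restrict (Metric.ball p (2 * r))) ≤ M →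
      ∀ u : Plane → ℝ,
        IsSchrodingerSolutionOn h E V u (Metric.ball p (2 * r)) →
        ∫⁻ x in Metric.ball p r, ‖u x‖ₑ ^ 2 ≤
          ENNReal.ofReal C₀ *
            ∫⁻ x in Metric.ball p (2 * r) \ Metric.ball p r, ‖u x‖ₑ ^ 2 := by
  obtain ⟨ρ, hρ, C, hC, hmain⟩ := exists_ball_lintegral_le_annulus
  obtain ⟨K, hK⟩ := hI.isBounded.exists_norm_le
  have hb : 0 < b := ha.trans_le hab
  -- This quantity bounds the rescaled potential: `2r ≤ b h ε(h)` gives `s/h ≤ b ε(h) / (2ρ)`, and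
  -- `|V - E| ≤ M + |K|`.
  have hev : ∀ᶠ h in nhdsWithin (0 : ℝ) (Set.Ioi 0),
      (b * shrinkParam c R₀ h / (2 * ρ)) ^ 2 * (M + |K|) < 1 := by
    have h1 : Filter.Tendsto (fun h ↦ (b * shrinkParam c R₀ h / (2 * ρ)) ^ 2 * (M + |K|))
        (nhdsWithin 0 (Set.Ioi 0)) (nhds ((b * 0 / (2 * ρ)) ^ 2 * (M + |K|))) :=
      ((((tendsto_shrinkParam c hR₀).const_mul b).div_const _).pow 2).mul_const _
    exact h1.eventually_lt_const (by simp)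
  obtain ⟨h₁, hh₁, hsmall⟩ := mem_nhdsGT_iff_exists_Ioo_subset.1 hev
  refine ⟨C, hC, min h₁ R₀, lt_min hh₁ hR₀, fun h hh hlt E hE p r har hrb V hV hVM u hu ↦ ?_⟩
  have hε : 0 < shrinkParam c R₀ h := by
    refine div_pos hc (Real.log_pos ?_)
    rw [one_lt_div hh]
    exact hlt.trans_le (min_le_right _ _)
  have hr : 0 < r := by
    have : 0 < a * (h * shrinkParam c R₀ h) := by positivity
    linarith
  set s : ℝ := r / ρ with hsdef
  have hs : 0 < s := by positivity
  have hsr : s * ρ = r := div_mul_cancel₀ r hρ.ne'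
  set T := affineScaling p hs.ne' with hT
  have hpre1 : T ⁻¹' Metric.ball p r = Metric.ball 0 ρ := by
    rw [← hsr]
    exact preimage_affineScaling_ball p hs ρ
  have hpre2 : T ⁻¹' Metric.ball p (2 * r) = Metric.ball 0 (2 * ρ) := by
    rw [← hsr, ← preimage_affineScaling_ball p hs (2 * ρ)]
    congr 2
    ring
  have hsol := hu.comp_affineScaling hh.ne' Metric.isOpen_ball p hs.ne'
  rw [← hT, hpre2] at hsol
  have hqmp : Measure.QuasiMeasurePreserving T (volume.restrict (Metric.ball 0 (2 * ρ)))
      (volume.restrict (Metric.ball p (2 * r))) := by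
    refine ⟨T.measurable, ?_⟩
    rw [← hpre2, hT, map_affineScaling_restrict]
    exact Measure.smul_absolutelyContinuous
  have hVae : ∀ᵐ x ∂volume.restrict (Metric.ball p (2 * r)), |V x| ≤ M := by
    have h1 := ae_le_eLpNormEssSup (f := V) (μ := volume.restrict (Metric.ball p (2 * r)))
    rw [eLpNorm_exponent_top] at hVM
    filter_upwards [h1] with x hx
    have h2 := hx.trans hVM
    rw [← Real.norm_eq_abs, ← coe_nnnorm]
    exact_mod_cast h2
  have hsle : s / h ≤ b * shrinkParam c R₀ h / (2 * ρ) := by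
    rw [hsdef, div_div, div_le_div_iff₀ (by positivity) (by positivity)]
    nlinarith
  have key := hmain _ _ ?_ ?_ hsol
  · rw [← hpre1, ← hpre2, ← Set.preimage_sdiff, hT,
      lintegral_comp_affineScaling p hs.ne' _ (fun x ↦ ‖u x‖ₑ ^ 2),
      lintegral_comp_affineScaling p hs.ne' _ (fun x ↦ ‖u x‖ₑ ^ 2), mul_left_comm] at key
    -- Both sides carry the same Jacobian `s⁻²`, so `C` survives the rescaling unchanged.
    refine (ENNReal.mul_le_mul_iff_right ?_ ENNReal.ofReal_ne_top).1 key
    rw [Ne, ENNReal.ofReal_eq_zero, not_le]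
    positivity
  · exact ((hV.1.comp_quasiMeasurePreserving hqmp).sub aestronglyMeasurable_const).const_mul _
  · filter_upwards [hqmp.ae hVae] with y hy
    have h1 : |V (T y) - E| ≤ M + |K| :=
      (abs_sub _ _).trans (add_le_add hy ((hK E hE).trans (le_abs_self K)))
    calc |s ^ 2 / h ^ 2 * (V (T y) - E)| = (s / h) ^ 2 * |V (T y) - E| := by
          rw [abs_mul, ← div_pow, abs_of_nonneg (by positivity)]
      _ ≤ (b * shrinkParam c R₀ h / (2 * ρ)) ^ 2 * (M + |K|) := by gcongr
      _ ≤ 1 := (hsmall ⟨hh, hlt.trans_le (min_le_left _ _)⟩).le
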